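/- Let $p$ be a prime, $1\le r\le s$, and let $\alpha,\beta,\gamma$ be integers coprime to $p$. Let $\phi:\mathbb Z_{p^s}\to\mathbb Z_{p^r}$ be reduction mod $p^r$, extended coefficientwise to polynomials (and the identity on $\mathbb Z_{p^r}[x]$). Let $R_{\alpha,\beta,\gamma}=\mathbb Z_{p^r}[x]/\langle x^\alpha-1\rangle\times\mathbb Z_{p^r}[x]/\langle x^\beta-1\rangle\times\mathbb Z_{p^s}[x]/\langle x^\gamma-1\rangle$, with elements written $(u|v|w)$, be the $\mathbb Z_{p^s}[x]$-module with $\eta*(u|v|w)=(\phi(\eta)u\,|\,\phi(\eta)v\,|\,\eta w)$; $\langle\cdot\rangle$ denotes the generated submodule. Let $C\subseteq\mathbb Z_{p^r}^\alpha\times\mathbb Z_{p^r}^\beta\times\mathbb Z_{p^s}^\gamma$ be a $\mathbb Z_{p^r}\mathbb Z_{p^r}\mathbb Z_{p^s}$-additive cyclic code, i.e. a $\mathbb Z_{p^s}$-submodule (scalars acting on the first two blocks through $\phi$) stable under the simultaneous cyclic shift of the three blocks; vectors are identified with polynomials, so that $C\subseteq R_{\alpha,\beta,\gamma}$. Write $\mathcal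 A=\sum_{i<r}p^ia_i$, $\mathcal B=\sum_{i<r}p^ib_i$ over $\mathbb Z_{p^r}$ and $\mathcal G=\sum_{i<s}p^ig_i$ over $\mathbb Z_{p^s}$, where all $a_i,b_i,g_i$ are monic and $$(\mathrm a)\ a_{r-1}|\cdots|a_0|x^\alpha-1,\qquad(\mathrm b)\ b_{r-1}|\cdots|b_0|x^\beta-1,\qquad(\mathrm g)\ g_{s-1}|\cdots|g_0|x^\gamma-1 ;$$ put $\deg\mathcal A=\deg a_0$, $\deg\mathcal B=\deg b_0$, $h_{\mathcal B}=\frac{x^\beta-1}{b_{r-1}}$, $h_{\mathcal G}=\phi\big(\frac{x^\gamma-1}{g_{s-1}}\big)$, and $\deg 0=-\infty$. Divisibility by $\mathcal A$ (by $\mathcal B$) is meant in $\mathbb Z_{p^r}[x]/\langle x^\alpha-1\rangle$ (in $\mathbb Z_{p^r}[x]/\langle x^\beta-1\rangle$). A *standard system of generators* of $C$ consists of such $\mathcal A,\mathcal B,\mathcal G$ and of $l,l_1,l_2\in\mathbb Z_{p^r}[x]$ with $\deg l<\deg\mathcal A$, $\deg l_1<\deg\mathcal A$, $\deg l_2<\deg\mathcal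 B$, such that $C=\langle(\mathcal A|0|0),(l|\mathcal B|0),(l_1|l_2|\mathcal G)\rangle$, $\{(u|v|0)\in C\}=\langle(\mathcal A|0|0),(l|\mathcal B|0)\rangle$ and $\{(u|0|0)\in C\}=\langle(\mathcal A|0|0)\rangle$. **Theorem.** $C$ has a standard system of generators. Every standard system of generators of $C$ satisfies (14) below, and it satisfies (i), for $1\le i\le 13$, whenever those of its three generators that are not listed in (i) are zero in $R_{\alpha,\beta,\gamma}$ and those of $l,l_1,l_2$ that are replaced by $0$ in the generators listed in (i) are zero. 1. $C=\langle(\mathcal A|0|0)\rangle$, with (a). 2. $C=\langle(0|\mathcal B|0)\rangle$, with (b). 3. $C=\langle(0|0|\mathcal G)\rangle$, with (g). 4. $C=\langle(l|\mathcal B|0)\rangle$, with (b) and $(x^\alpha-1)\mid h_{\mathcal B}l$. 5. $C=\langle(l_1|l_2|\mathcal G)\rangle$, with (g), $(x^\alpha-1)\mid h_{\mathcal G}l_1$ and $(x^\beta-1)\mid h_{\mathcal G}l_2$. 6. $C=\langle(\mathcal A|0|0),(l|\mathcal B|0)\rangle$, with (a), (b), $\deg l<\deg\mathcal A$ and $\mathcal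 A\mid h_{\mathcal B}l$. 7. $C=\langle(\mathcal A|0|0),(l_1|l_2|\mathcal G)\rangle$, with (a), (g), $\deg l_1<\deg\mathcal A$, $\mathcal A\mid h_{\mathcal G}l_1$ and $(x^\beta-1)\mid h_{\mathcal G}l_2$. 8. $C=\langle(l|\mathcal B|0),(l_1|l_2|\mathcal G)\rangle$, with (b), (g), $\deg l_2<\deg\mathcal B$, $(x^\alpha-1)\mid h_{\mathcal B}l$, $\mathcal B\mid h_{\mathcal G}l_2$, and $(x^\alpha-1)\mid Ql-h_{\mathcal G}l_1$ for every $Q\in\mathbb Z_{p^r}[x]$ with $Q\mathcal B=h_{\mathcal G}l_2$ in $\mathbb Z_{p^r}[x]/\langle x^\beta-1\rangle$. 9. $C=\langle(0|\mathcal B|0),(0|l_2|\mathcal G)\rangle$, with (b), (g), $\deg l_2<\deg\mathcal B$ and $\mathcal B\mid h_{\mathcal G}l_2$. 10. $C=\langle(\mathcal A|0|0),(0|\mathcal B|0),(l_1|l_2|\mathcal G)\rangle$, with (a), (b), (g), $\deg l_1<\deg\mathcal A$, $\mathcal A\mid h_{\mathcal G}l_1$, $\deg l_2<\deg\mathcal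 B$ and $\mathcal B\mid h_{\mathcal G}l_2$. 11. $C=\langle(\mathcal A|0|0),(0|\mathcal B|0),(0|0|\mathcal G)\rangle$, with (a), (b), (g). 12. $C=\langle(\mathcal A|0|0),(l|\mathcal B|0),(l_1|0|\mathcal G)\rangle$, with (a), (b), (g), $\deg l<\deg\mathcal A$, $\deg l_1<\deg\mathcal A$, $\mathcal A\mid h_{\mathcal G}l_1$ and $\mathcal A\mid h_{\mathcal B}l$. 13. $C=\langle(\mathcal A|0|0),(l|\mathcal B|0),(0|l_2|\mathcal G)\rangle$, with (a), (b), (g), $\deg l<\deg\mathcal A$, $\mathcal A\mid h_{\mathcal B}l$, $\deg l_2<\deg\mathcal B$ and $\mathcal B\mid h_{\mathcal G}l_2$. 14. $C=\langle(\mathcal A|0|0),(l|\mathcal B|0),(l_1|l_2|\mathcal G)\rangle$, with (a), (b), (g), $\deg l<\deg\mathcal A$, $\deg l_1<\deg\mathcal A$, $\deg l_2<\deg\mathcal B$, $\mathcal A\mid h_{\mathcal B}l$, $\mathcal B\mid h_{\mathcal G}l_2$, and $\mathcal A\mid Ql-h_{\mathcal G}l_1$ for every $Q\in\mathbb Z_{p^r}[x]$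 with $Q\mathcal B=h_{\mathcal G}l_2$ in $\mathbb Z_{p^r}[x]/\langle x^\beta-1\rangle$. In particular every such code is of at least one of the fourteen forms. -/

import Mathlib

namespace TripleCyclic

open Polynomial

/-- The underlying set `ℤ_{p^r}^α × ℤ_{p^r}^β × ℤ_{p^s}^γ` of words `(u | v | w)`. -/
abbrev Word (p r s α β γ : ℕ) : Type :=
  (Fin α → ZMod (p ^ r)) × (Fin β → ZMod (p ^ r)) × (Fin γ → ZMod (p ^ s))

/-- Reduction modulo `p ^ r`, as a ring homomorphism `ℤ_{p^s} → ℤ_{p^r}`. -/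
def phi (p : ℕ) {r s : ℕ} (h : r ≤ s) : ZMod (p ^ s) →+* ZMod (p ^ r) :=
  ZMod.castHom (pow_dvd_pow p h) (ZMod (p ^ r))

/-- Coefficientwise reduction `ℤ_{p^s}[x] → ℤ_{p^r}[x]`. -/
noncomputable def phiPoly (p : ℕ) {r s : ℕ} (h : r ≤ s) :
    (ZMod (p ^ s))[X] →+* (ZMod (p ^ r))[X] :=
  Polynomial.mapRingHom (phi p h)

/-- The external multiplication `b * (u | v | w) = (φ(b) u | φ(b) v | b w)` of words. -/
def scale {p r s α β γ : ℕ} (h : r ≤ s) (b : ZMod (p ^ s)) (c : Word p r s α β γ) :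
    Word p r s α β γ :=
  (fun i => phi p h b * c.1 i, fun i => phi p h b * c.2.1 i, fun i => b * c.2.2 i)

/-- The cyclic shift `(u_0, …, u_{n-1}) ↦ (u_{n-1}, u_0, …, u_{n-2})`. -/
def shift {R : Type*} {n : ℕ} (u : Fin n → R) : Fin n → R :=
  fun i => u ((finRotate n).symm i)

/-- `C` is a `ℤ_{p^r}ℤ_{p^r}ℤ_{p^s}`-additive cyclic code of block length `(α, β, γ)`:
a `ℤ_{p^s}`-submodule of the set of words that is stable under the simultaneous cyclic shift
of the three blocks. -/
structure IsAdditiveCyclicCode {p r s α β γ : ℕ} (h : r ≤ s)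
    (C : Set (Word p r s α β γ)) : Prop where
  nonempty : C.Nonempty
  add_mem : ∀ c ∈ C, ∀ d ∈ C, c + d ∈ C
  scale_mem : ∀ b : ZMod (p ^ s), ∀ c ∈ C, scale h b c ∈ C
  shift_mem : ∀ c ∈ C, (shift c.1, shift c.2.1, shift c.2.2) ∈ C

/-- The ring `R[x] / ⟨x^n - 1⟩`. -/
abbrev CycRing (R : Type) [CommRing R] (n : ℕ) : Type :=
  R[X] ⧸ Ideal.span ({X ^ n - 1} : Set R[X])

/-- The class of a polynomial in `R[x] / ⟨x^n - 1⟩`. -/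
noncomputable abbrev cls {R : Type} [CommRing R] (n : ℕ) : R[X] →+* CycRing R n :=
  Ideal.Quotient.mk (Ideal.span ({X ^ n - 1} : Set R[X]))

/-- `R_{α,β,γ} = ℤ_{p^r}[x]/⟨x^α-1⟩ × ℤ_{p^r}[x]/⟨x^β-1⟩ × ℤ_{p^s}[x]/⟨x^γ-1⟩`. The proof of
`r ≤ s` is recorded in the type because the action of `ℤ_{p^s}[x]` below depends on it. -/
def Ambient (p : ℕ) {r s : ℕ} (_h : r ≤ s) (α β γ : ℕ) : Type :=
  CycRing (ZMod (p ^ r)) α × CycRing (ZMod (p ^ r)) β × CycRing (ZMod (p ^ s)) γ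

noncomputable instance (p : ℕ) {r s : ℕ} (h : r ≤ s) (α β γ : ℕ) :
    CommRing (Ambient p h α β γ) :=
  inferInstanceAs (CommRing
    (CycRing (ZMod (p ^ r)) α × CycRing (ZMod (p ^ r)) β × CycRing (ZMod (p ^ s)) γ))

/-- The ring homomorphism `η ↦ (φ(η) | φ(η) | η)` from `ℤ_{p^s}[x]` to `R_{α,β,γ}`. -/
noncomputable def scalars (p : ℕ) {r s : ℕ} (h : r ≤ s) (α β γ : ℕ) :
    (ZMod (p ^ s))[X] →+* Ambient p h α β γ :=
  RingHom.prod ((cls α).comp (phiPoly p h)) (RingHom.prod ((cls β).comp (phiPoly p h)) (cls γ))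

/-- The action `η * (u | v | w) = (φ(η) u | φ(η) v | η w)` of `ℤ_{p^s}[x]` on `R_{α,β,γ}`. -/
noncomputable instance (p : ℕ) {r s : ℕ} (h : r ≤ s) (α β γ : ℕ) :
    Module (ZMod (p ^ s))[X] (Ambient p h α β γ) :=
  Module.compHom (Ambient p h α β γ) (scalars p h α β γ)

/-- The element `(u(x) | v(x) | w(x))` of `R_{α,β,γ}` given by three polynomials. -/
noncomputable def vec {p r s : ℕ} (h : r ≤ s) (α β γ : ℕ) (u v : (ZMod (p ^ r))[X])
    (w : (ZMod (p ^ s))[X]) : Ambient p h α β γ :=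
  (cls α u, cls β v, cls γ w)

/-- The action, written out on elements given by polynomials. -/
theorem smul_vec {p r s : ℕ} (h : r ≤ s) (α β γ : ℕ) (η : (ZMod (p ^ s))[X])
    (u v : (ZMod (p ^ r))[X]) (w : (ZMod (p ^ s))[X]) :
    η • vec h α β γ u v w =
      vec h α β γ (phiPoly p h η * u) (phiPoly p h η * v) (η * w) := by
  unfold vec
  rw [map_mul, map_mul, map_mul]
  rfl

/-- The polynomial `u_0 + u_1 x + ⋯ + u_{n-1} x^{n-1}` of a vector. -/
noncomputable def toPoly {R : Type} [CommRing R] {n : ℕ} (u : Fin n → R) : R[X] :=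
  ∑ i : Fin n, Polynomial.C (u i) * X ^ (i : ℕ)

/-- The set of elements `(u(x) | v(x) | w(x))` of `R_{α,β,γ}` that correspond to the
codewords of `C`. -/
def polyCode {p r s α β γ : ℕ} (h : r ≤ s) (C : Set (Word p r s α β γ)) :
    Set (Ambient p h α β γ) :=
  (fun c => vec h α β γ (toPoly c.1) (toPoly c.2.1) (toPoly c.2.2)) '' C

/-- The `ℤ_{p^s}[x]`-submodule `⟨S⟩` of `R_{α,β,γ}` generated by `S`, as a set. -/
def gen {p r s : ℕ} (h : r ≤ s) {α β γ : ℕ} (S : Set (Ambient p h α β γ)) :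
    Set (Ambient p h α β γ) :=
  (Submodule.span (ZMod (p ^ s))[X] S : Set (Ambient p h α β γ))

/-- `f_0, …, f_{k-1}` are monic polynomials over `ℤ_{p^k}` with
`f_{k-1} ∣ ⋯ ∣ f_1 ∣ f_0 ∣ x^n - 1`. (Only the indices below `k` matter.) -/
structure DivChain (p k n : ℕ) (f : ℕ → (ZMod (p ^ k))[X]) : Prop where
  monic : ∀ i < k, (f i).Monic
  dvd_top : f 0 ∣ X ^ n - 1
  dvd_succ : ∀ i, i + 1 < k → f (i + 1) ∣ f i

/-- `f_0 + p f_1 + ⋯ + p^{k-1} f_{k-1}`. -/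
noncomputable def chainSum (p k : ℕ) (f : ℕ → (ZMod (p ^ k))[X]) : (ZMod (p ^ k))[X] :=
  ∑ i ∈ Finset.range k, Polynomial.C ((p : ZMod (p ^ k)) ^ i) * f i

/-- Divisibility `f ∣ g` in `R[x] / ⟨x^n - 1⟩` of the classes of two polynomials. -/
def DvdMod {R : Type} [CommRing R] (n : ℕ) (f g : R[X]) : Prop :=
  cls n f ∣ cls n g

/-- The polynomials entering a system of generators
`(𝒜 | 0 | 0)`, `(l | ℬ | 0)`, `(l₁ | l₂ | 𝒢)`. -/
structure GenSystem (p r s : ℕ) where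
  a : ℕ → (ZMod (p ^ r))[X]
  b : ℕ → (ZMod (p ^ r))[X]
  g : ℕ → (ZMod (p ^ s))[X]
  l : (ZMod (p ^ r))[X]
  l₁ : (ZMod (p ^ r))[X]
  l₂ : (ZMod (p ^ r))[X]

namespace GenSystem

variable {p r s : ℕ} (S : GenSystem p r s)

/-- `𝒜 = a_0 + p a_1 + ⋯ + p^{r-1} a_{r-1}`. -/
noncomputable def A : (ZMod (p ^ r))[X] := chainSum p r S.a

/-- `ℬ = b_0 + p b_1 + ⋯ + p^{r-1} b_{r-1}`. -/
noncomputable def B : (ZMod (p ^ r))[X] := chainSum p r S.b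

/-- `𝒢 = g_0 + p g_1 + ⋯ + p^{s-1} g_{s-1}`. -/
noncomputable def G : (ZMod (p ^ s))[X] := chainSum p s S.g

/-- `(x^β - 1) / b_{r-1}`, a polynomial over `ℤ_{p^r}` (on which `φ` is the identity). -/
noncomputable def hB (β : ℕ) : (ZMod (p ^ r))[X] := (X ^ β - 1) /ₘ S.b (r - 1)

/-- `φ((x^γ - 1) / g_{s-1})`. -/
noncomputable def hG (h : r ≤ s) (γ : ℕ) : (ZMod (p ^ r))[X] :=
  phiPoly p h ((X ^ γ - 1) /ₘ S.g (s - 1))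

variable (h : r ≤ s) (α β γ : ℕ)

/-- The first generator `(𝒜 | 0 | 0)`. -/
noncomputable def e₁ : Ambient p h α β γ := vec h α β γ S.A 0 0

/-- The second generator `(l | ℬ | 0)`. -/
noncomputable def e₂ : Ambient p h α β γ := vec h α β γ S.l S.B 0

/-- The third generator `(l₁ | l₂ | 𝒢)`. -/
noncomputable def e₃ : Ambient p h α β γ := vec h α β γ S.l₁ S.l₂ S.G

variable {α β γ} (C : Set (Word p r s α β γ))

/-- `S` is a standard system of generators of `C`: `𝒜`, `ℬ`, `𝒢` come from divisor chains of
`x^α - 1`, `x^β - 1`, `x^γ - 1`, the mixed components are reduced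
(`deg 𝒜`, `deg ℬ` being the degrees of `a_0`, `b_0`), the three generators generate `C`, the
first two generate the subcode of all `(u | v | 0)` in `C`, and the first one generates the
subcode of all `(u | 0 | 0)` in `C`. -/
structure IsStandard : Prop where
  chain_a : DivChain p r α S.a
  chain_b : DivChain p r β S.b
  chain_g : DivChain p s γ S.g
  deg_l : S.l.degree < (S.a 0).degree
  deg_l₁ : S.l₁.degree < (S.a 0).degree
  deg_l₂ : S.l₂.degree < (S.b 0).degree
  gen_all : polyCode h C = gen h {S.e₁ h α β γ, S.e₂ h α β γ, S.e₃ h α β γ}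
  gen_two : {c ∈ polyCode h C | c.2.2 = 0} = gen h {S.e₁ h α β γ, S.e₂ h α β γ}
  gen_one : {c ∈ polyCode h C | c.2.1 = 0 ∧ c.2.2 = 0} = gen h {S.e₁ h α β γ}

/-- `C = ⟨(𝒜 | 0 | 0)⟩`. -/
def Case1 : Prop :=
  polyCode h C = gen h {vec h α β γ S.A 0 0} ∧ DivChain p r α S.a

/-- `C = ⟨(0 | ℬ | 0)⟩`. -/
def Case2 : Prop :=
  polyCode h C = gen h {vec h α β γ 0 S.B 0} ∧ DivChain p r β S.b

/-- `C = ⟨(0 | 0 | 𝒢)⟩`. -/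
def Case3 : Prop :=
  polyCode h C = gen h {vec h α β γ 0 0 S.G} ∧ DivChain p s γ S.g

/-- `C = ⟨(l | ℬ | 0)⟩`. -/
def Case4 : Prop :=
  polyCode h C = gen h {vec h α β γ S.l S.B 0} ∧ DivChain p r β S.b ∧
  X ^ α - 1 ∣ S.hB β * S.l

/-- `C = ⟨(l₁ | l₂ | 𝒢)⟩`. -/
def Case5 : Prop :=
  polyCode h C = gen h {vec h α β γ S.l₁ S.l₂ S.G} ∧ DivChain p s γ S.g ∧
  X ^ α - 1 ∣ S.hG h γ * S.l₁ ∧ X ^ β - 1 ∣ S.hG h γ * S.l₂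

/-- `C = ⟨(𝒜 | 0 | 0), (l | ℬ | 0)⟩`. -/
def Case6 : Prop :=
  polyCode h C = gen h {vec h α β γ S.A 0 0, vec h α β γ S.l S.B 0} ∧
  DivChain p r α S.a ∧ DivChain p r β S.b ∧
  S.l.degree < (S.a 0).degree ∧ DvdMod α S.A (S.hB β * S.l)

/-- `C = ⟨(𝒜 | 0 | 0), (l₁ | l₂ | 𝒢)⟩`. -/
def Case7 : Prop :=
  polyCode h C = gen h {vec h α β γ S.A 0 0, vec h α β γ S.l₁ S.l₂ S.G} ∧
  DivChain p r α S.a ∧ DivChain p s γ S.g ∧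
  S.l₁.degree < (S.a 0).degree ∧ DvdMod α S.A (S.hG h γ * S.l₁) ∧
  X ^ β - 1 ∣ S.hG h γ * S.l₂

/-- `C = ⟨(l | ℬ | 0), (l₁ | l₂ | 𝒢)⟩`. -/
def Case8 : Prop :=
  polyCode h C = gen h {vec h α β γ S.l S.B 0, vec h α β γ S.l₁ S.l₂ S.G} ∧
  DivChain p r β S.b ∧ DivChain p s γ S.g ∧
  S.l₂.degree < (S.b 0).degree ∧
  X ^ α - 1 ∣ S.hB β * S.l ∧
  DvdMod β S.B (S.hG h γ * S.l₂) ∧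
  ∀ Q : (ZMod (p ^ r))[X], cls β (Q * S.B) = cls β (S.hG h γ * S.l₂) →
    X ^ α - 1 ∣ Q * S.l - S.hG h γ * S.l₁

/-- `C = ⟨(0 | ℬ | 0), (0 | l₂ | 𝒢)⟩`. -/
def Case9 : Prop :=
  polyCode h C = gen h {vec h α β γ 0 S.B 0, vec h α β γ 0 S.l₂ S.G} ∧
  DivChain p r β S.b ∧ DivChain p s γ S.g ∧
  S.l₂.degree < (S.b 0).degree ∧ DvdMod β S.B (S.hG h γ * S.l₂)

/-- `C = ⟨(𝒜 | 0 | 0), (0 | ℬ | 0), (l₁ | l₂ | 𝒢)⟩`. -/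
def Case10 : Prop :=
  polyCode h C =
    gen h {vec h α β γ S.A 0 0, vec h α β γ 0 S.B 0, vec h α β γ S.l₁ S.l₂ S.G} ∧
  DivChain p r α S.a ∧ DivChain p r β S.b ∧ DivChain p s γ S.g ∧
  S.l₁.degree < (S.a 0).degree ∧ DvdMod α S.A (S.hG h γ * S.l₁) ∧
  S.l₂.degree < (S.b 0).degree ∧ DvdMod β S.B (S.hG h γ * S.l₂)

/-- `C = ⟨(𝒜 | 0 | 0), (0 | ℬ | 0), (0 | 0 | 𝒢)⟩`. -/
def Case11 : Prop :=
  polyCode h C = gen h {vec h α β γ S.A 0 0, vec h α β γ 0 S.B 0, vec h α β γ 0 0 S.G} ∧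
  DivChain p r α S.a ∧ DivChain p r β S.b ∧ DivChain p s γ S.g

/-- `C = ⟨(𝒜 | 0 | 0), (l | ℬ | 0), (l₁ | 0 | 𝒢)⟩`. -/
def Case12 : Prop :=
  polyCode h C =
    gen h {vec h α β γ S.A 0 0, vec h α β γ S.l S.B 0, vec h α β γ S.l₁ 0 S.G} ∧
  DivChain p r α S.a ∧ DivChain p r β S.b ∧ DivChain p s γ S.g ∧
  S.l.degree < (S.a 0).degree ∧ S.l₁.degree < (S.a 0).degree ∧
  DvdMod α S.A (S.hG h γ * S.l₁) ∧ DvdMod α S.A (S.hB β * S.l)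

/-- `C = ⟨(𝒜 | 0 | 0), (l | ℬ | 0), (0 | l₂ | 𝒢)⟩`. -/
def Case13 : Prop :=
  polyCode h C =
    gen h {vec h α β γ S.A 0 0, vec h α β γ S.l S.B 0, vec h α β γ 0 S.l₂ S.G} ∧
  DivChain p r α S.a ∧ DivChain p r β S.b ∧ DivChain p s γ S.g ∧
  S.l.degree < (S.a 0).degree ∧ DvdMod α S.A (S.hB β * S.l) ∧
  S.l₂.degree < (S.b 0).degree ∧ DvdMod β S.B (S.hG h γ * S.l₂)

/-- `C = ⟨(𝒜 | 0 | 0), (l | ℬ | 0), (l₁ | l₂ | 𝒢)⟩`. -/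
def Case14 : Prop :=
  polyCode h C =
    gen h {vec h α β γ S.A 0 0, vec h α β γ S.l S.B 0, vec h α β γ S.l₁ S.l₂ S.G} ∧
  DivChain p r α S.a ∧ DivChain p r β S.b ∧ DivChain p s γ S.g ∧
  S.l.degree < (S.a 0).degree ∧ S.l₁.degree < (S.a 0).degree ∧
  S.l₂.degree < (S.b 0).degree ∧
  DvdMod α S.A (S.hB β * S.l) ∧
  DvdMod β S.B (S.hG h γ * S.l₂) ∧
  ∀ Q : (ZMod (p ^ r))[X], cls β (Q * S.B) = cls β (S.hG h γ * S.l₂) →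
    DvdMod α S.A (Q * S.l - S.hG h γ * S.l₁)

end GenSystem

end TripleCyclic

namespace TripleCyclic

open Polynomial

/-! The code is filtered by the words `(u|v|0)` and, inside them, `(u|0|0)`. The last nonzero block
at each level runs through an ideal of a polynomial ring containing `x^n - 1`, with `n` one of `α`,
`β`, `γ`. Lifting a generator of each ideal back to the code gives the three generators: any
codeword is reduced to zero by clearing its third, second and first block in turn.

Everything rests on the structure of an ideal `I` of `ℤ_{p^k}[x]` containing `x^n - 1`
(`exists_divChain_span`). The residues modulo `p` of the `f` with `p^i f ∈ I` form an increasing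
chain of principal ideals of `𝔽_p[x]`. Their generators divide `x^n - 1`, which is separable because
`p ∤ n`, so Hensel lifting (`exists_monic_dvd_lift`) turns them into a divisor chain `f_i` over
`ℤ_{p^k}`. Coprimality of complementary factors (`mul_mem_of_residue_eq`) puts `p^i f_i` in `I` and
also recovers each `p^i f_i` from the single sum of all of them.

The divisibility conditions are syzygies. A multiplier that kills the last block of a generator, or
a combination of two generators whose later blocks cancel, gives a word one or two levels down,
where the generator of that level must divide it. The special cases follow by dropping zero
generators. -/

/-- Reduction modulo `p` of polynomials over `ℤ_{p^k}`. -/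
noncomputable def residue (p : ℕ) {k : ℕ} (hk : 1 ≤ k) : (ZMod (p ^ k))[X] →+* (ZMod p)[X] :=
  mapRingHom (ZMod.castHom (dvd_pow_self p (Nat.one_le_iff_ne_zero.1 hk)) (ZMod p))

/-! ### Hensel lifting from `𝔽_p[x]` to `ℤ_{p^k}[x]` -/

section Lifting

variable {p k : ℕ} (hk : 1 ≤ k)

theorem residue_surjective : Function.Surjective (residue p hk) :=
  map_surjective _ (ZMod.castHom_surjective _)

theorem C_p_pow_self : (C ((p : ZMod (p ^ k)) ^ k)) = 0 := by
  rw [← Nat.cast_pow, ZMod.natCast_self, C_0]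

theorem residue_C_p_mul (f : (ZMod (p ^ k))[X]) :
    residue p hk (C (p : ZMod (p ^ k)) * f) = 0 := by
  simp [residue]

theorem exists_eq_C_p_mul (hp : p.Prime) {f : (ZMod (p ^ k))[X]} (hf : residue p hk f = 0) :
    ∃ g, f = C (p : ZMod (p ^ k)) * g := by
  have : NeZero (p ^ k) := ⟨(pow_pos hp.pos k).ne'⟩
  refine (C_dvd_iff_dvd_coeff _ _).2 fun i => ?_
  have hi : ZMod.castHom (dvd_pow_self p (Nat.one_le_iff_ne_zero.1 hk)) (ZMod p)
      (f.coeff i) = 0 := by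
    rw [← coeff_map]
    exact (congrArg (fun q => coeff q i) hf).trans (coeff_zero i)
  rw [← ZMod.natCast_zmod_val (f.coeff i), map_natCast, ZMod.natCast_eq_zero_iff] at hi
  rw [← ZMod.natCast_zmod_val (f.coeff i)]
  exact_mod_cast Nat.cast_dvd_cast (α := ZMod (p ^ k)) hi

theorem exists_eq_add_C_p_mul (hp : p.Prime) {f g : (ZMod (p ^ k))[X]}
    (h : residue p hk f = residue p hk g) : ∃ w, f = g + C (p : ZMod (p ^ k)) * w := by
  obtain ⟨w, hw⟩ := exists_eq_C_p_mul hk hp (f := f - g) (by rw [map_sub, h, sub_self])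
  exact ⟨w, by rw [← hw]; ring⟩

/-- Coprimality can be tested modulo `p`. -/
theorem isCoprime_of_residue (hp : p.Prime) {f g : (ZMod (p ^ k))[X]}
    (h : IsCoprime (residue p hk f) (residue p hk g)) : IsCoprime f g := by
  obtain ⟨a, b, hab⟩ := h
  obtain ⟨a, rfl⟩ := residue_surjective hk a
  obtain ⟨b, rfl⟩ := residue_surjective hk b
  obtain ⟨w, hw⟩ := exists_eq_add_C_p_mul hk hp (f := a * f + b * g) (g := 1)
    (by simpa using hab)
  -- A Bézout relation modulo `p` lifts to `a f + b g = 1 + p w`, which is a unit because `p` is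
  -- nilpotent.
  have hnil : IsNilpotent (C (p : ZMod (p ^ k)) * w) :=
    ⟨k, by rw [mul_pow, ← C_pow, C_p_pow_self, zero_mul]⟩
  obtain ⟨v, hv⟩ := hnil.isUnit_one_add.exists_left_inv
  refine ⟨v * a, v * b, ?_⟩
  rw [← hw] at hv
  linear_combination hv

/-- Hensel's lemma: a monic divisor modulo `p` of a polynomial that is separable modulo `p`
lifts to a monic divisor. -/
theorem exists_monic_dvd_lift (hp : p.Prime) {F : (ZMod (p ^ k))[X]} {t : (ZMod p)[X]}
    (hsep : (residue p hk F).Separable) (ht : t.Monic) (hdvd : t ∣ residue p hk F) :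
    ∃ f : (ZMod (p ^ k))[X], f.Monic ∧ residue p hk f = t ∧ f ∣ F := by
  have : Fact p.Prime := ⟨hp⟩
  have : Fact (1 < p ^ k) := ⟨Nat.one_lt_pow (by omega) hp.one_lt⟩
  -- A factorization modulo `p^(m+1)` is improved step by step; at `m = k - 1` the error term
  -- vanishes.
  suffices H : ∀ m : ℕ, ∃ f h z : (ZMod (p ^ k))[X], f.Monic ∧ residue p hk f = t ∧
      F = f * h + C (p : ZMod (p ^ k)) ^ (m + 1) * z by
    obtain ⟨f, h, z, hf, hft, hF⟩ := H (k - 1)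
    refine ⟨f, hf, hft, h, ?_⟩
    rw [hF, Nat.sub_add_cancel hk, ← C_pow, C_p_pow_self, zero_mul, add_zero]
  intro m
  induction m with
  | zero =>
    obtain ⟨u, hu⟩ := hdvd
    obtain ⟨h, rfl⟩ := residue_surjective hk u
    obtain ⟨f, hft, -, hf⟩ := lifts_and_degree_eq_and_monic
      ((mem_lifts t).2 (residue_surjective hk t)) ht
    obtain ⟨z, hz⟩ := exists_eq_add_C_p_mul hk hp (f := F) (g := f * h) (by
      rw [hu, map_mul, ← hft]; rfl)
    exact ⟨f, h, z, hf, hft, by simpa using hz⟩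
  | succ m ih =>
    obtain ⟨f, h, z, hf, hft, hF⟩ := ih
    have hres : residue p hk F = residue p hk f * residue p hk h := by
      rw [hF, pow_succ', mul_assoc, map_add, residue_C_p_mul, add_zero, map_mul]
    obtain ⟨a, b, hab⟩ := isCoprime_of_residue hk hp (f := f) (g := h) (by
      rw [hres] at hsep
      exact hsep.isCoprime)
    -- With `a f + b h = 1`, the natural corrections to `f` and `h` are `p^(m+1) b z` and `p^(m+1) a
    -- z`. Replacing `b z` by its remainder `e` modulo `f` keeps the new `f` monic; the quotient `q`
    -- moves to the other factor. The remaining error is the product of the two corrections.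
    have hdiv := modByMonic_add_div (b * z) f
    have hdeg := degree_modByMonic_lt (b * z) hf
    set e := (b * z) %ₘ f
    set q := (b * z) /ₘ f
    set P := C (p : ZMod (p ^ k))
    have hP : P ^ (m + 1) * e = C ((p : ZMod (p ^ k)) ^ (m + 1)) * e := by rw [C_pow]
    refine ⟨f + P ^ (m + 1) * e, h + P ^ (m + 1) * (z * a + h * q),
      -(P ^ m * e * (z * a + h * q)), ?_, ?_, ?_⟩
    · refine hf.add_of_left (lt_of_le_of_lt ?_ hdeg)
      rw [hP]
      rw [← smul_eq_C_mul]
      exact degree_smul_le _ _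
    · rw [map_add, hft, pow_succ', mul_assoc, residue_C_p_mul, add_zero]
    · rw [hF]
      linear_combination (-P ^ (m + 1) * z) * hab - P ^ (m + 1) * h * hdiv

end Lifting

/-! ### Ideals of `ℤ_{p^k}[x]` containing `x^n - 1` -/

section Ideals

variable {p k n : ℕ} (hk : 1 ≤ k)

theorem separable_X_pow_sub_one {m : ℕ} (hm : n.Coprime m) :
    (X ^ n - 1 : (ZMod m)[X]).Separable := by
  have := separable_X_pow_sub_C_unit (R := ZMod m) 1 ((ZMod.isUnit_iff_coprime n m).2 hm)
  simpa using this

theorem residue_X_pow_sub_one : residue p hk (X ^ n - 1) = X ^ n - 1 := by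
  simp [residue]

/-- If `I` contains `x^n - 1` and `p^i g` with `g` congruent modulo `p` to a divisor `f` of
`x^n - 1`, then it contains `p^i f`. -/
theorem mul_mem_of_residue_eq (hp : p.Prime) (hn : n.Coprime p) {I : Ideal (ZMod (p ^ k))[X]}
    (hI : X ^ n - 1 ∈ I) {c f g : (ZMod (p ^ k))[X]} (hf : f ∣ X ^ n - 1)
    (hfg : residue p hk g = residue p hk f) (hg : c * g ∈ I) : c * f ∈ I := by
  obtain ⟨h, hF⟩ := hf
  have hsep := separable_X_pow_sub_one hn
  rw [← residue_X_pow_sub_one hk, hF, map_mul, ← hfg] at hsep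
  -- Modulo `p`, `g h` is the separable polynomial `x^n - 1`, so `g` is coprime to the cofactor `h`
  -- of `f`.
  obtain ⟨a, b, hab⟩ := isCoprime_of_residue hk hp hsep.isCoprime
  have : c * f = (a * f) * (c * g) + (b * c) * (X ^ n - 1) := by
    rw [hF]
    linear_combination (-c * f) * hab
  rw [this]
  exact I.add_mem (I.mul_mem_left _ hg) (I.mul_mem_left _ hI)

/-- The ideal of residues modulo `p` of the polynomials `f` with `p^i f ∈ I`. -/
noncomputable def torsionIdeal (I : Ideal (ZMod (p ^ k))[X]) (i : ℕ) : Ideal (ZMod p)[X] :=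
  Ideal.map (residue p hk)
    (Submodule.comap (LinearMap.mulLeft (ZMod (p ^ k))[X] (C (p : ZMod (p ^ k)) ^ i)) I)

theorem mem_torsionIdeal {I : Ideal (ZMod (p ^ k))[X]} {i : ℕ} {t : (ZMod p)[X]} :
    t ∈ torsionIdeal hk I i ↔
      ∃ f, C (p : ZMod (p ^ k)) ^ i * f ∈ I ∧ residue p hk f = t :=
  Ideal.mem_map_iff_of_surjective _ (residue_surjective hk)

/-- A chain of monic divisors of `x^n - 1` generating the torsion ideals of `I`. -/
theorem exists_torsion_chain (hp : p.Prime) (hn : n.Coprime p)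
    {I : Ideal (ZMod (p ^ k))[X]} (hI : X ^ n - 1 ∈ I) :
    ∃ f : ℕ → (ZMod (p ^ k))[X], (∀ i, (f i).Monic) ∧ (∀ i, f i ∣ X ^ n - 1) ∧
      (∀ i, f (i + 1) ∣ f i) ∧
      ∀ i, torsionIdeal hk I i = Ideal.span {residue p hk (f i)} := by
  have : Fact p.Prime := ⟨hp⟩
  have hF0 : (X ^ n - 1 : (ZMod p)[X]) ≠ 0 := (separable_X_pow_sub_one hn).ne_zero
  have hFT : ∀ i, (X ^ n - 1 : (ZMod p)[X]) ∈ torsionIdeal hk I i := fun i =>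
    (mem_torsionIdeal hk).2 ⟨_, I.mul_mem_left _ hI, residue_X_pow_sub_one hk⟩
  have hgen : ∀ i, ∃ t : (ZMod p)[X], t.Monic ∧ torsionIdeal hk I i = Ideal.span {t} := by
    intro i
    obtain ⟨t, ht⟩ := (IsPrincipalIdealRing.principal (torsionIdeal hk I i)).principal
    have ht0 : t ≠ 0 := by
      rintro rfl
      have := hFT i
      rw [ht] at this
      exact hF0 (by simpa using this)
    refine ⟨normalize t, monic_normalize ht0, ?_⟩
    rw [ht]
    exact (Ideal.span_singleton_eq_span_singleton.2 (normalize_associated t)).symm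
  choose t htm ht using hgen
  have ht0 : t 0 ∣ X ^ n - 1 := by
    rw [← Ideal.mem_span_singleton, ← ht]
    exact hFT 0
  have hts : ∀ i, t (i + 1) ∣ t i := by
    intro i
    rw [← Ideal.span_singleton_le_span_singleton, ← ht, ← ht]
    intro q hq
    obtain ⟨f, hf, rfl⟩ := (mem_torsionIdeal hk).1 hq
    refine (mem_torsionIdeal hk).2 ⟨f, ?_, rfl⟩
    rw [pow_succ', mul_assoc]
    exact I.mul_mem_left _ hf
  have hsep : (residue p hk (X ^ n - 1)).Separable := by
    rw [residue_X_pow_sub_one]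
    exact separable_X_pow_sub_one hn
  obtain ⟨f₀, hf₀m, hf₀, hf₀d⟩ := exists_monic_dvd_lift hk hp hsep (htm 0)
    (by rwa [residue_X_pow_sub_one])
  -- The next divisor is lifted inside the previous lift rather than inside `x^n - 1`, so that the
  -- chain divides over `ℤ_{p^k}` and not only modulo `p`.
  have hstep : ∀ (i : ℕ) (f : {f : (ZMod (p ^ k))[X] //
      f.Monic ∧ residue p hk f = t i ∧ f ∣ X ^ n - 1}),
      ∃ f' : {f' : (ZMod (p ^ k))[X] //
        f'.Monic ∧ residue p hk f' = t (i + 1) ∧ f' ∣ X ^ n - 1}, f'.1 ∣ f.1 := by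
    rintro i ⟨f, hfm, hf, hfd⟩
    obtain ⟨f', h1, h2, h3⟩ := exists_monic_dvd_lift hk hp
      (hsep.of_dvd (map_dvd (residue p hk) hfd)) (htm (i + 1)) (by rw [hf]; exact hts i)
    exact ⟨⟨f', h1, h2, h3.trans hfd⟩, h3⟩
  choose next hnext using hstep
  let f : ∀ i, {f : (ZMod (p ^ k))[X] // f.Monic ∧ residue p hk f = t i ∧ f ∣ X ^ n - 1} :=
    fun i => Nat.rec ⟨f₀, hf₀m, hf₀, hf₀d⟩ next i
  refine ⟨fun i => (f i).1, fun i => (f i).2.1, fun i => (f i).2.2.2,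
    fun i => hnext i (f i), fun i => ?_⟩
  rw [ht, (f i).2.2.1]

/-- Once the terms before `i` are known to lie in `J`, what remains of the sum is `p^i (f_i +
p(⋯))`, and `mul_mem_of_residue_eq` discards the multiple of `p`. Thus the sum alone yields every
summand. -/
theorem chainSum_tail_mem (hk : 1 ≤ k) (hp : p.Prime) (hn : n.Coprime p) {J : Ideal (ZMod (p ^ k))[X]}
    (hJ : X ^ n - 1 ∈ J) {f : ℕ → (ZMod (p ^ k))[X]} (hf : ∀ i, f i ∣ X ^ n - 1)
    (hsum : chainSum p k f ∈ J) {i : ℕ} (hi : i < k) :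
    C (p : ZMod (p ^ k)) ^ i * f i ∈ J := by
  induction i using Nat.strong_induction_on with
  | _ i ih =>
    have htail : ∑ j ∈ Finset.Ico i k, C (p : ZMod (p ^ k)) ^ j * f j ∈ J := by
      have h1 : chainSum p k f = ∑ j ∈ Finset.range i, C (p : ZMod (p ^ k)) ^ j * f j +
          ∑ j ∈ Finset.Ico i k, C (p : ZMod (p ^ k)) ^ j * f j := by
        rw [Finset.sum_range_add_sum_Ico _ hi.le]
        simp only [chainSum, C_pow]
      rw [h1] at hsum
      refine (J.add_mem_iff_right (J.sum_mem fun j hj => ?_)).1 hsum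
      have := Finset.mem_range.1 hj
      exact ih j this (this.trans hi)
    rw [Finset.sum_eq_sum_Ico_succ_bot hi] at htail
    refine mul_mem_of_residue_eq hk hp hn hJ (hf i)
      (g := f i + C (p : ZMod (p ^ k)) *
        ∑ j ∈ Finset.Ico (i + 1) k, C (p : ZMod (p ^ k)) ^ (j - (i + 1)) * f j) ?_ ?_
    · rw [map_add, residue_C_p_mul, add_zero]
    · convert htail using 1
      rw [mul_add, Finset.mul_sum, Finset.mul_sum]
      congr 1
      refine Finset.sum_congr rfl fun j hj => ?_
      obtain ⟨d, rfl⟩ := Nat.exists_eq_add_of_le (Finset.mem_Ico.1 hj).1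
      rw [Nat.add_sub_cancel_left]
      ring

/-- Structure of the ideals of `ℤ_{p^k}[x]` containing `x^n - 1`, for `n` coprime to `p`. -/
theorem exists_divChain_span (hp : p.Prime) (hk : 1 ≤ k) (hn : n.Coprime p)
    {I : Ideal (ZMod (p ^ k))[X]} (hI : X ^ n - 1 ∈ I) :
    ∃ f, DivChain p k n f ∧ f 0 ∈ I ∧ I = Ideal.span {chainSum p k f, X ^ n - 1} := by
  obtain ⟨f, hfm, hfd, hfs, hfT⟩ := exists_torsion_chain hk hp hn hI
  have hmem : ∀ i, C (p : ZMod (p ^ k)) ^ i * f i ∈ I := by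
    intro i
    have : residue p hk (f i) ∈ torsionIdeal hk I i := by
      rw [hfT]
      exact Ideal.mem_span_singleton_self _
    obtain ⟨g, hg, hgf⟩ := (mem_torsionIdeal hk).1 this
    exact mul_mem_of_residue_eq hk hp hn hI (hfd i) hgf hg
  refine ⟨f, ⟨fun i _ => hfm i, hfd 0, fun i _ => hfs i⟩, by simpa using hmem 0, ?_⟩
  apply le_antisymm
  · have hJ : X ^ n - 1 ∈ Ideal.span {chainSum p k f, X ^ n - 1} :=
      Ideal.subset_span (by simp)
    have hS : chainSum p k f ∈ Ideal.span {chainSum p k f, X ^ n - 1} :=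
      Ideal.subset_span (by simp)
    generalize Ideal.span {chainSum p k f, X ^ n - 1} = J at hJ hS
    -- Descending induction on the exponent `i = k - d`, starting from `p^k = 0`: modulo `p`, `y` is
    -- a multiple of `f_i`, and subtracting that multiple leaves an element divisible by `p^(i+1)`.
    suffices H : ∀ d i, i + d = k → ∀ y, C (p : ZMod (p ^ k)) ^ i * y ∈ I →
        C (p : ZMod (p ^ k)) ^ i * y ∈ J by
      intro y hy
      simpa using H k 0 (zero_add k) y (by simpa using hy)
    intro d
    induction d with
    | zero =>
      intro i hi y _
      rw [add_zero] at hi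
      rw [hi, ← C_pow, C_p_pow_self, zero_mul]
      exact J.zero_mem
    | succ d ih =>
      intro i hi y hy
      have hyT : residue p hk y ∈ torsionIdeal hk I i := (mem_torsionIdeal hk).2 ⟨y, hy, rfl⟩
      rw [hfT, Ideal.mem_span_singleton] at hyT
      obtain ⟨q, hq⟩ := hyT
      obtain ⟨q, rfl⟩ := residue_surjective hk q
      obtain ⟨w, rfl⟩ := exists_eq_add_C_p_mul hk hp (f := y) (g := q * f i)
        (by rw [hq, map_mul, mul_comm])
      have hsplit : C (p : ZMod (p ^ k)) ^ i * (q * f i + C (p : ZMod (p ^ k)) * w) =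
          q * (C (p : ZMod (p ^ k)) ^ i * f i) + C (p : ZMod (p ^ k)) ^ (i + 1) * w := by ring
      rw [hsplit] at hy ⊢
      refine J.add_mem (J.mul_mem_left _ (chainSum_tail_mem hk hp hn hJ hfd hS (by omega)))
        (ih (i + 1) (by omega) w ?_)
      exact (I.add_mem_iff_right (I.mul_mem_left _ (hmem i))).1 hy
  · rw [Ideal.span_le, Set.insert_subset_iff, Set.singleton_subset_iff]
    refine ⟨I.sum_mem fun i _ => ?_, hI⟩
    rw [C_pow]
    exact hmem i

end Ideals

/-! ### Cyclic codes as polynomial submodules -/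

section Code

variable {p r s α β γ : ℕ} {h : r ≤ s}

theorem cls_X_pow_sub_one {R : Type} [CommRing R] (n : ℕ) : cls n (X ^ n - 1 : R[X]) = 0 :=
  Ideal.Quotient.eq_zero_iff_mem.2 (Ideal.mem_span_singleton_self _)

theorem cls_eq_zero_iff {R : Type} [CommRing R] {n : ℕ} {f : R[X]} :
    cls n f = 0 ↔ X ^ n - 1 ∣ f :=
  Ideal.Quotient.eq_zero_iff_mem.trans Ideal.mem_span_singleton

theorem phiPoly_surjective : Function.Surjective (phiPoly p h) :=
  map_surjective _ (ZMod.castHom_surjective _)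

theorem vec_surjective (c : Ambient p h α β γ) : ∃ u v w, c = vec h α β γ u v w := by
  obtain ⟨c₁, c₂, c₃⟩ := c
  obtain ⟨u, rfl⟩ := Ideal.Quotient.mk_surjective c₁
  obtain ⟨v, rfl⟩ := Ideal.Quotient.mk_surjective c₂
  obtain ⟨w, rfl⟩ := Ideal.Quotient.mk_surjective c₃
  exact ⟨u, v, w, rfl⟩

theorem vec_add (u v u' v' : (ZMod (p ^ r))[X]) (w w' : (ZMod (p ^ s))[X]) :
    vec h α β γ u v w + vec h α β γ u' v' w' = vec h α β γ (u + u') (v + v') (w + w') := by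
  unfold vec
  rw [map_add, map_add, map_add]
  rfl

theorem vec_sub (u v u' v' : (ZMod (p ^ r))[X]) (w w' : (ZMod (p ^ s))[X]) :
    vec h α β γ u v w - vec h α β γ u' v' w' = vec h α β γ (u - u') (v - v') (w - w') := by
  unfold vec
  rw [map_sub, map_sub, map_sub]
  rfl

theorem vec_zero : vec h α β γ (0 : (ZMod (p ^ r))[X]) 0 0 = 0 := by
  unfold vec
  rw [map_zero, map_zero, map_zero]
  rfl

theorem vec_congr {u v u' v' : (ZMod (p ^ r))[X]} {w w' : (ZMod (p ^ s))[X]}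
    (hu : cls α u = cls α u') (hv : cls β v = cls β v') (hw : cls γ w = cls γ w') :
    vec h α β γ u v w = vec h α β γ u' v' w' := by
  unfold vec
  rw [hu, hv, hw]

theorem vec_eq_zero_iff {u v : (ZMod (p ^ r))[X]} {w : (ZMod (p ^ s))[X]} :
    vec h α β γ u v w = 0 ↔ cls α u = 0 ∧ cls β v = 0 ∧ cls γ w = 0 := by
  rw [← vec_zero]
  unfold vec
  rw [map_zero, map_zero, map_zero]
  exact Prod.mk_inj.trans (and_congr_right' Prod.mk_inj)

theorem toPoly_add {R : Type} [CommRing R] {n : ℕ} (u v : Fin n → R) :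
    toPoly (u + v) = toPoly u + toPoly v := by
  simp [toPoly, add_mul, Finset.sum_add_distrib]

theorem toPoly_mul {R : Type} [CommRing R] {n : ℕ} (b : R) (u : Fin n → R) :
    toPoly (fun i => b * u i) = C b * toPoly u := by
  simp [toPoly, Finset.mul_sum, mul_assoc]

/-- The cyclic shift corresponds to multiplication by `x`. -/
theorem cls_toPoly_shift {R : Type} [CommRing R] {n : ℕ} (u : Fin n → R) :
    cls n (toPoly (shift u)) = cls n (X * toPoly u) := by
  cases n with
  | zero => simp [toPoly]
  | succ n =>
    have h1 : toPoly (shift u) =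
        ∑ i : Fin (n + 1), Polynomial.C (u i) * X ^ (finRotate (n + 1) i : ℕ) := by
      rw [toPoly, ← Equiv.sum_comp (finRotate (n + 1))]
      simp [shift]
    rw [h1, toPoly, Finset.mul_sum, map_sum, map_sum]
    refine Finset.sum_congr rfl fun i _ => ?_
    have h2 : cls (n + 1) (X ^ (n + 1) : R[X]) = 1 := by
      have := cls_X_pow_sub_one (R := R) (n + 1)
      rwa [map_sub, map_one, sub_eq_zero] at this
    -- Only the last index wraps around, from `n` to `0`, and there `x^(n+1) = 1` in the quotient.
    have h3 : cls (n + 1) (X ^ (finRotate (n + 1) i : ℕ) : R[X]) =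
        cls (n + 1) (X ^ ((i : ℕ) + 1)) := by
      rcases eq_or_ne i (Fin.last n) with rfl | hi
      · rw [finRotate_last, Fin.val_last, h2]
        simp
      · rw [coe_finRotate_of_ne_last hi]
    rw [map_mul, h3, ← map_mul]
    congr 1
    ring

/-- An additive cyclic code, as a `ℤ_{p^s}[x]`-submodule. -/
theorem exists_submodule_eq_polyCode {C : Set (Word p r s α β γ)}
    (hC : IsAdditiveCyclicCode h C) :
    ∃ M : Submodule (ZMod (p ^ s))[X] (Ambient p h α β γ), (M : Set _) = polyCode h C := by
  have hadd : ∀ {a b}, a ∈ polyCode h C → b ∈ polyCode h C → a + b ∈ polyCode h C := by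
    rintro _ _ ⟨c, hc, rfl⟩ ⟨d, hd, rfl⟩
    exact ⟨c + d, hC.add_mem c hc d hd, by simp [vec_add, toPoly_add]⟩
  have hscale : ∀ (b : ZMod (p ^ s)) {a}, a ∈ polyCode h C →
      Polynomial.C b • a ∈ polyCode h C := by
    rintro b _ ⟨c, hc, rfl⟩
    exact ⟨scale h b c, hC.scale_mem b c hc,
      by simp [smul_vec, scale, toPoly_mul, phiPoly]⟩
  have hshift : ∀ {a}, a ∈ polyCode h C → (X : (ZMod (p ^ s))[X]) • a ∈ polyCode h C := by
    rintro _ ⟨c, hc, rfl⟩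
    refine ⟨_, hC.shift_mem c hc, ?_⟩
    rw [smul_vec]
    refine vec_congr ?_ ?_ (cls_toPoly_shift _)
    · simpa [phiPoly] using cls_toPoly_shift c.1
    · simpa [phiPoly] using cls_toPoly_shift c.2.1
  refine ⟨⟨⟨⟨polyCode h C, hadd⟩, ?_⟩, ?_⟩, rfl⟩
  · obtain ⟨c, hc⟩ := hC.nonempty
    have := hscale 0 (Set.mem_image_of_mem _ hc)
    rwa [C_0, zero_smul] at this
  · intro q a ha
    induction q using Polynomial.induction_on with
    | C b => exact hscale b ha
    | add f g hf hg =>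
      rw [add_smul]
      exact hadd hf hg
    | monomial n b hb =>
      rw [pow_succ, ← mul_assoc, mul_comm, mul_smul]
      exact hshift hb

end Code

/-! ### Existence of a standard system -/

section Existence

variable {p r s α β γ : ℕ} {h : r ≤ s}
  (M : Submodule (ZMod (p ^ s))[X] (Ambient p h α β γ))

/-- The polynomials `u` with `(u | 0 | 0) ∈ M`. -/
noncomputable def firstIdeal : Ideal (ZMod (p ^ r))[X] where
  carrier := {u | vec h α β γ u 0 0 ∈ M}
  add_mem' {u u'} hu hu' := by
    have := M.add_mem hu hu'
    rwa [vec_add, add_zero, add_zero] at this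
  zero_mem' := by
    change vec h α β γ 0 0 0 ∈ M
    rw [vec_zero]
    exact M.zero_mem
  smul_mem' q u hu := by
    -- Scalars reach this block only through `φ`; its surjectivity makes the set stable under all of
    -- `ℤ_{p^r}[x]`.
    obtain ⟨η, rfl⟩ := phiPoly_surjective (h := h) q
    have := M.smul_mem η hu
    rwa [smul_vec, mul_zero, mul_zero] at this

/-- The polynomials `v` with `(u | v | 0) ∈ M` for some `u`. -/
noncomputable def secondIdeal : Ideal (ZMod (p ^ r))[X] where
  carrier := {v | ∃ u, vec h α β γ u v 0 ∈ M}
  add_mem' := by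
    rintro v v' ⟨u, hu⟩ ⟨u', hu'⟩
    refine ⟨u + u', ?_⟩
    have := M.add_mem hu hu'
    rwa [vec_add, add_zero] at this
  zero_mem' := ⟨0, by rw [vec_zero]; exact M.zero_mem⟩
  smul_mem' q := by
    rintro v ⟨u, hu⟩
    obtain ⟨η, rfl⟩ := phiPoly_surjective (h := h) q
    refine ⟨phiPoly p h η * u, ?_⟩
    have := M.smul_mem η hu
    rwa [smul_vec, mul_zero] at this

/-- The polynomials `w` with `(u | v | w) ∈ M` for some `u` and `v`. -/
noncomputable def thirdIdeal : Ideal (ZMod (p ^ s))[X] where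
  carrier := {w | ∃ u v, vec h α β γ u v w ∈ M}
  add_mem' := by
    rintro w w' ⟨u, v, hu⟩ ⟨u', v', hu'⟩
    refine ⟨u + u', v + v', ?_⟩
    have := M.add_mem hu hu'
    rwa [vec_add] at this
  zero_mem' := ⟨0, 0, by rw [vec_zero]; exact M.zero_mem⟩
  smul_mem' η := by
    rintro w ⟨u, v, hu⟩
    refine ⟨phiPoly p h η * u, phiPoly p h η * v, ?_⟩
    have := M.smul_mem η hu
    rwa [smul_vec] at this

variable {M}

theorem mem_firstIdeal {u : (ZMod (p ^ r))[X]} :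
    u ∈ firstIdeal M ↔ vec h α β γ u 0 0 ∈ M := Iff.rfl

/-- A class in the ideal generated by `F` and `x^n - 1` is a multiple of the class of `F`. -/
theorem exists_cls_eq_mul {R : Type} [CommRing R] {n : ℕ} {F f : R[X]}
    (hf : f ∈ Ideal.span {F, X ^ n - 1}) : ∃ q, cls n f = cls n (q * F) := by
  obtain ⟨q, q', rfl⟩ := Ideal.mem_span_pair.1 hf
  exact ⟨q, by rw [map_add, map_mul _ q', cls_X_pow_sub_one, mul_zero, add_zero]⟩

/-- Changing the first component by a multiple of `a ∈ firstIdeal M`. -/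
theorem vec_modByMonic_mem {a u v : (ZMod (p ^ r))[X]} {w : (ZMod (p ^ s))[X]}
    (ha : a ∈ firstIdeal M) (hu : vec h α β γ u v w ∈ M) :
    vec h α β γ (u %ₘ a) v w ∈ M := by
  have := M.sub_mem hu (mem_firstIdeal.1 ((firstIdeal M).mul_mem_right (u /ₘ a) ha))
  rwa [vec_sub, sub_zero, sub_zero, ← modByMonic_eq_sub_mul_div u a] at this

/-- Each of the three ideals has a chain sum as generator modulo `x^n - 1`; preimages of these in
the code are the generators, after their mixed components have been reduced. -/
theorem exists_isStandard (hp : p.Prime) (hr : 1 ≤ r) (hα : α.Coprime p) (hβ : β.Coprime p)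
    (hγ : γ.Coprime p) {C : Set (Word p r s α β γ)} (hC : IsAdditiveCyclicCode h C) :
    ∃ S : GenSystem p r s, S.IsStandard h C := by
  have : Fact (1 < p ^ r) := ⟨Nat.one_lt_pow (by omega) hp.one_lt⟩
  obtain ⟨M, hM⟩ := exists_submodule_eq_polyCode hC
  have mem_gen : ∀ S : Set (Ambient p h α β γ), ∀ c, c ∈ gen h S ↔
      c ∈ Submodule.span (ZMod (p ^ s))[X] S := fun _ _ => Iff.rfl
  have mem_code : ∀ c, c ∈ polyCode h C ↔ c ∈ M := fun c => by rw [← hM]; rfl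
  obtain ⟨a, ha, ha0, haI⟩ := exists_divChain_span hp hr hα (I := firstIdeal M) (by
    rw [mem_firstIdeal, vec_eq_zero_iff.2 ⟨cls_X_pow_sub_one α, map_zero _, map_zero _⟩]
    exact M.zero_mem)
  obtain ⟨b, hb, hb0, hbI⟩ := exists_divChain_span hp hr hβ (I := secondIdeal M) ⟨0, by
    rw [vec_eq_zero_iff.2 ⟨map_zero _, cls_X_pow_sub_one β, map_zero _⟩]
    exact M.zero_mem⟩
  obtain ⟨g, hg, -, hgI⟩ := exists_divChain_span hp (hr.trans h) hγ (I := thirdIdeal M) ⟨0, 0, by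
    rw [vec_eq_zero_iff.2 ⟨map_zero _, map_zero _, cls_X_pow_sub_one γ⟩]
    exact M.zero_mem⟩
  have hA : vec h α β γ (chainSum p r a) 0 0 ∈ M := by
    rw [← mem_firstIdeal, haI]
    exact Ideal.subset_span (by simp)
  have hB : chainSum p r b ∈ secondIdeal M := by
    rw [hbI]
    exact Ideal.subset_span (by simp)
  have hG : chainSum p s g ∈ thirdIdeal M := by
    rw [hgI]
    exact Ideal.subset_span (by simp)
  obtain ⟨l, hl⟩ := hB
  obtain ⟨l₁, l₂, hl₂⟩ := hG
  -- Reduction uses the monic `b 0`, which lies in the ideal itself. A codeword with second block `b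
  -- 0 * (l₂ /ₘ b 0)` carries some first block `u'`, so `l₁` becomes `l₁ - u'` before it is reduced
  -- modulo `a 0`.
  obtain ⟨u', hu'⟩ := (secondIdeal M).mul_mem_right (l₂ /ₘ b 0) hb0
  have hl₂' := M.sub_mem hl₂ hu'
  rw [vec_sub, sub_zero, ← modByMonic_eq_sub_mul_div l₂ (b 0)] at hl₂'
  replace hl := vec_modByMonic_mem ha0 hl
  replace hl₂' := vec_modByMonic_mem ha0 hl₂'
  have one : ∀ u, vec h α β γ u 0 0 ∈ M → ∃ η : (ZMod (p ^ s))[X],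
      η • vec h α β γ (chainSum p r a) 0 0 = vec h α β γ u 0 0 := by
    intro u hu
    rw [← mem_firstIdeal, haI] at hu
    obtain ⟨q, hq⟩ := exists_cls_eq_mul hu
    obtain ⟨η, rfl⟩ := phiPoly_surjective (h := h) q
    exact ⟨η, by rw [smul_vec, mul_zero, mul_zero]; exact vec_congr hq.symm rfl rfl⟩
  have two : ∀ u v, vec h α β γ u v 0 ∈ M → ∃ η θ : (ZMod (p ^ s))[X],
      η • vec h α β γ (chainSum p r a) 0 0 +
        θ • vec h α β γ (l %ₘ a 0) (chainSum p r b) 0 = vec h α β γ u v 0 := by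
    intro u v huv
    have hv : v ∈ secondIdeal M := ⟨u, huv⟩
    rw [hbI] at hv
    obtain ⟨q, hq⟩ := exists_cls_eq_mul hv
    obtain ⟨θ, rfl⟩ := phiPoly_surjective (h := h) q
    -- Subtracting this multiple clears the second block and leaves a word `(u|0|0)`, covered by
    -- `one`.
    have hd := M.sub_mem huv (M.smul_mem θ hl)
    have hd' : vec h α β γ u v 0 - θ • vec h α β γ (l %ₘ a 0) (chainSum p r b) 0 =
        vec h α β γ (u - phiPoly p h θ * (l %ₘ a 0)) 0 0 := by
      rw [smul_vec, vec_sub]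
      exact vec_congr rfl (by rw [map_sub, hq, sub_self, map_zero]) (by simp)
    rw [hd'] at hd
    obtain ⟨η, hη⟩ := one _ hd
    exact ⟨η, θ, by rw [hη, ← hd', sub_add_cancel]⟩
  have three : ∀ u v w, vec h α β γ u v w ∈ M → ∃ η θ ι : (ZMod (p ^ s))[X],
      η • vec h α β γ (chainSum p r a) 0 0 +
        θ • vec h α β γ (l %ₘ a 0) (chainSum p r b) 0 +
        ι • vec h α β γ ((l₁ - u') %ₘ a 0) (l₂ %ₘ b 0) (chainSum p s g) =
          vec h α β γ u v w := by
    intro u v w huv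
    have hw : w ∈ thirdIdeal M := ⟨u, v, huv⟩
    rw [hgI] at hw
    obtain ⟨ι, hι⟩ := exists_cls_eq_mul hw
    have hd := M.sub_mem huv (M.smul_mem ι hl₂')
    have hd' : vec h α β γ u v w - ι • vec h α β γ ((l₁ - u') %ₘ a 0) (l₂ %ₘ b 0)
          (chainSum p s g) =
        vec h α β γ (u - phiPoly p h ι * ((l₁ - u') %ₘ a 0))
          (v - phiPoly p h ι * (l₂ %ₘ b 0)) 0 := by
      rw [smul_vec, vec_sub]
      exact vec_congr rfl rfl (by rw [map_sub, hι, sub_self, map_zero])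
    rw [hd'] at hd
    obtain ⟨η, θ, hη⟩ := two _ _ hd
    exact ⟨η, θ, ι, by rw [hη, ← hd', sub_add_cancel]⟩
  refine ⟨⟨a, b, g, l %ₘ a 0, (l₁ - u') %ₘ a 0, l₂ %ₘ b 0⟩, ha, hb, hg,
    degree_modByMonic_lt _ (ha.monic 0 hr), degree_modByMonic_lt _ (ha.monic 0 hr),
    degree_modByMonic_lt _ (hb.monic 0 hr), ?_, ?_, ?_⟩
  · ext c
    rw [mem_code, mem_gen, Submodule.mem_span_triple]
    constructor
    · intro hc
      obtain ⟨u, v, w, rfl⟩ := vec_surjective c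
      exact three u v w hc
    · rintro ⟨η, θ, ι, rfl⟩
      exact M.add_mem (M.add_mem (M.smul_mem _ hA) (M.smul_mem _ hl)) (M.smul_mem _ hl₂')
  · ext c
    rw [Set.mem_ofPred_eq, mem_code, mem_gen, Submodule.mem_span_pair]
    constructor
    · rintro ⟨hc, hc0⟩
      obtain ⟨u, v, w, rfl⟩ := vec_surjective c
      have hw : vec h α β γ u v w = vec h α β γ u v 0 :=
        vec_congr rfl rfl (hc0.trans (map_zero _).symm)
      rw [hw] at hc ⊢
      exact two u v hc
    · rintro ⟨η, θ, rfl⟩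
      refine ⟨M.add_mem (M.smul_mem _ hA) (M.smul_mem _ hl), ?_⟩
      simp only [GenSystem.e₁, GenSystem.e₂, smul_vec, vec_add]
      simp [vec]
  · ext c
    rw [Set.mem_ofPred_eq, mem_code, mem_gen, Submodule.mem_span_singleton]
    constructor
    · rintro ⟨hc, hc0, hc1⟩
      obtain ⟨u, v, w, rfl⟩ := vec_surjective c
      have hw : vec h α β γ u v w = vec h α β γ u 0 0 :=
        vec_congr rfl (hc0.trans (map_zero _).symm) (hc1.trans (map_zero _).symm)
      rw [hw] at hc ⊢
      exact one u hc
    · rintro ⟨η, rfl⟩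
      refine ⟨M.smul_mem _ hA, ?_⟩
      simp only [GenSystem.e₁, smul_vec]
      simp [vec]

end Existence

/-! ### Divisibility conditions -/

section Conditions

theorem DivChain.dvd_of_le {p k n : ℕ} {f : ℕ → (ZMod (p ^ k))[X]} (hf : DivChain p k n f)
    {i j : ℕ} (hij : i ≤ j) (hj : j < k) : f j ∣ f i := by
  induction j, hij using Nat.le_induction with
  | base => exact dvd_rfl
  | succ j _ ih => exact (hf.dvd_succ j hj).trans (ih (by omega))

/-- `((x^n - 1) / f_{k-1}) (f_0 + p f_1 + ⋯ + p^{k-1} f_{k-1})` vanishes modulo `x^n - 1`. -/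
theorem DivChain.cls_div_mul_chainSum {p k n : ℕ} {f : ℕ → (ZMod (p ^ k))[X]} (hk : 1 ≤ k)
    (hf : DivChain p k n f) : cls n ((X ^ n - 1) /ₘ f (k - 1) * chainSum p k f) = 0 := by
  have hlast : k - 1 < k := by omega
  have hmul : f (k - 1) * ((X ^ n - 1) /ₘ f (k - 1)) = X ^ n - 1 := by
    have := modByMonic_add_div (X ^ n - 1) (f (k - 1))
    rwa [(modByMonic_eq_zero_iff_dvd (hf.monic _ hlast)).2
      ((hf.dvd_of_le (Nat.zero_le _) hlast).trans hf.dvd_top), zero_add] at this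
  have hdvd : f (k - 1) ∣ chainSum p k f := Finset.dvd_sum fun i hi =>
    Dvd.dvd.mul_left (hf.dvd_of_le (by have := Finset.mem_range.1 hi; omega) hlast) _
  obtain ⟨q, hq⟩ := hdvd
  rw [cls_eq_zero_iff]
  refine ⟨q, ?_⟩
  rw [hq, ← mul_assoc, mul_comm _ (f (k - 1)), hmul]

namespace GenSystem

variable {p r s α β γ : ℕ} {h : r ≤ s} {S : GenSystem p r s} {C : Set (Word p r s α β γ)}

theorem IsStandard.dvdMod_A (hS : S.IsStandard h C) {u : (ZMod (p ^ r))[X]}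
    (hu : vec h α β γ u 0 0 ∈ polyCode h C) : DvdMod α S.A u := by
  have hmem : vec h α β γ u 0 0 ∈ {c ∈ polyCode h C | c.2.1 = 0 ∧ c.2.2 = 0} :=
    ⟨hu, map_zero _, map_zero _⟩
  rw [hS.gen_one] at hmem
  obtain ⟨η, hη⟩ := Submodule.mem_span_singleton.1 hmem
  rw [e₁, smul_vec] at hη
  have h1 : cls α (phiPoly p h η * S.A) = cls α u := congrArg Prod.fst hη
  exact ⟨cls α (phiPoly p h η), by rw [← h1, mul_comm, map_mul]⟩

theorem IsStandard.dvdMod_B (hS : S.IsStandard h C) {u v : (ZMod (p ^ r))[X]}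
    (hu : vec h α β γ u v 0 ∈ polyCode h C) : DvdMod β S.B v := by
  have hmem : vec h α β γ u v 0 ∈ {c ∈ polyCode h C | c.2.2 = 0} := ⟨hu, map_zero _⟩
  rw [hS.gen_two] at hmem
  obtain ⟨η, θ, hη⟩ := Submodule.mem_span_pair.1 hmem
  rw [e₁, e₂, smul_vec, smul_vec, vec_add, mul_zero, zero_add] at hη
  have h1 : cls β (phiPoly p h θ * S.B) = cls β v := congrArg (fun c => c.2.1) hη
  exact ⟨cls β (phiPoly p h θ), by rw [← h1, mul_comm, map_mul]⟩

theorem IsStandard.smul_add_smul_mem (hS : S.IsStandard h C) (η θ : (ZMod (p ^ s))[X]) :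
    η • S.e₂ h α β γ + θ • S.e₃ h α β γ ∈ polyCode h C := by
  rw [hS.gen_all]
  exact Submodule.add_mem _ (Submodule.smul_mem _ _ (Submodule.subset_span (by simp)))
    (Submodule.smul_mem _ _ (Submodule.subset_span (by simp)))

/-- `h_ℬ` annihilates `ℬ`, so `h_ℬ` times the second generator is the codeword `(h_ℬ l|0|0)`. -/
theorem IsStandard.dvdMod_hB_mul_l (hS : S.IsStandard h C) (hr : 1 ≤ r) :
    DvdMod α S.A (S.hB β * S.l) := by
  obtain ⟨η, hη⟩ := phiPoly_surjective (h := h) (S.hB β)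
  have hmem := hS.smul_add_smul_mem η 0
  have hB : cls β (S.hB β * S.B) = cls β 0 :=
    (hS.chain_b.cls_div_mul_chainSum hr).trans (map_zero _).symm
  rw [zero_smul, add_zero, e₂, smul_vec, hη, mul_zero, vec_congr rfl hB rfl] at hmem
  exact hS.dvdMod_A hmem

theorem cls_div_mul_G (hr : 1 ≤ r) (h : r ≤ s) (hS : DivChain p s γ S.g) :
    cls γ ((X ^ γ - 1) /ₘ S.g (s - 1) * S.G) = cls γ 0 :=
  (hS.cls_div_mul_chainSum (hr.trans h)).trans (map_zero _).symm

/-- Multiplying the third generator by `(x^γ - 1)/g_{s-1}` kills its last block and leaves `(h_𝒢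
l₁|h_𝒢 l₂|0)`. -/
theorem IsStandard.dvdMod_hG_mul_l₂ (hS : S.IsStandard h C) (hr : 1 ≤ r) :
    DvdMod β S.B (S.hG h γ * S.l₂) := by
  have hmem := hS.smul_add_smul_mem 0 ((X ^ γ - 1) /ₘ S.g (s - 1))
  rw [zero_smul, zero_add, e₃, smul_vec,
    vec_congr rfl rfl (cls_div_mul_G hr h hS.chain_g)] at hmem
  exact hS.dvdMod_B hmem

/-- `Q` times the second generator has the same second block as `(h_𝒢 l₁|h_𝒢 l₂|0)`; the difference
is a codeword supported on the first block. -/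
theorem IsStandard.dvdMod_sub (hS : S.IsStandard h C) (hr : 1 ≤ r) {Q : (ZMod (p ^ r))[X]}
    (hQ : cls β (Q * S.B) = cls β (S.hG h γ * S.l₂)) :
    DvdMod α S.A (Q * S.l - S.hG h γ * S.l₁) := by
  obtain ⟨η, rfl⟩ := phiPoly_surjective (h := h) Q
  have hmem := hS.smul_add_smul_mem η (-((X ^ γ - 1) /ₘ S.g (s - 1)))
  have hv : cls β (phiPoly p h η * S.B - S.hG h γ * S.l₂) = cls β 0 := by
    rw [map_sub, hQ, sub_self, map_zero]
  have hw : cls γ (0 - (X ^ γ - 1) /ₘ S.g (s - 1) * S.G) = cls γ 0 := by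
    rw [map_sub, cls_div_mul_G hr h hS.chain_g, sub_self, map_zero]
  rw [neg_smul, ← sub_eq_add_neg, e₂, e₃, smul_vec, smul_vec, vec_sub, mul_zero, ← hG,
    vec_congr rfl hv hw] at hmem
  exact hS.dvdMod_A hmem

theorem IsStandard.case14 (hS : S.IsStandard h C) (hr : 1 ≤ r) : S.Case14 h C :=
  ⟨hS.gen_all, hS.chain_a, hS.chain_b, hS.chain_g, hS.deg_l, hS.deg_l₁, hS.deg_l₂,
    hS.dvdMod_hB_mul_l hr, hS.dvdMod_hG_mul_l₂ hr, fun _ hQ => hS.dvdMod_sub hr hQ⟩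

/-- If the quotient `Q` contributes nothing, the last condition simplifies. -/
theorem IsStandard.dvdMod_hG_mul_l₁ (hS : S.IsStandard h C) (hr : 1 ≤ r)
    {Q : (ZMod (p ^ r))[X]} (hQ : cls β (Q * S.B) = cls β (S.hG h γ * S.l₂))
    (hQl : Q * S.l = 0) : DvdMod α S.A (S.hG h γ * S.l₁) := by
  have := hS.dvdMod_sub hr hQ
  rw [hQl, zero_sub, DvdMod, map_neg] at this
  exact dvd_neg.1 this

/-- Turns divisibility by `𝒜` or `ℬ` into honest divisibility by `x^n - 1` when the corresponding
generator vanishes. -/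
theorem dvd_of_dvdMod {R : Type} [CommRing R] {n : ℕ} {f g : R[X]} (hf : cls n f = 0)
    (hfg : DvdMod n f g) : X ^ n - 1 ∣ g := by
  rw [DvdMod, hf, zero_dvd_iff] at hfg
  exact cls_eq_zero_iff.1 hfg

theorem gen_insert_zero (T : Set (Ambient p h α β γ)) : gen h (insert 0 T) = gen h T := by
  rw [gen, Submodule.span_insert_zero, gen]

theorem gen_pair_zero (x : Ambient p h α β γ) : gen h {x, 0} = gen h {x} := by
  rw [Set.pair_comm, gen_insert_zero]

theorem gen_triple_zero (x y : Ambient p h α β γ) : gen h {x, y, 0} = gen h {x, y} := by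
  rw [Set.pair_comm y, Set.insert_comm, gen_insert_zero]

end GenSystem

end Conditions

end TripleCyclic

/-! ### The fourteen forms -/

open TripleCyclic GenSystem in
theorem theorem4p12 (p r s α β γ : ℕ) (hp : p.Prime) (hr : 1 ≤ r) (h : r ≤ s)
    (hα : Nat.Coprime α p) (hβ : Nat.Coprime β p) (hγ : Nat.Coprime γ p)
    (C : Set (TripleCyclic.Word p r s α β γ)) (hC : TripleCyclic.IsAdditiveCyclicCode h C) :
    (∃ S : TripleCyclic.GenSystem p r s, S.IsStandard h C) ∧
    ∀ S : TripleCyclic.GenSystem p r s, S.IsStandard h C →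
      (S.e₂ h α β γ = 0 → S.e₃ h α β γ = 0 → S.Case1 h C) ∧
      (S.e₁ h α β γ = 0 → S.l = 0 → S.e₃ h α β γ = 0 → S.Case2 h C) ∧
      (S.e₁ h α β γ = 0 → S.e₂ h α β γ = 0 → S.l₁ = 0 → S.l₂ = 0 → S.Case3 h C) ∧
      (S.e₁ h α β γ = 0 → S.e₃ h α β γ = 0 → S.Case4 h C) ∧
      (S.e₁ h α β γ = 0 → S.e₂ h α β γ = 0 → S.Case5 h C) ∧
      (S.e₃ h α β γ = 0 → S.Case6 h C) ∧
      (S.e₂ h α β γ = 0 → S.Case7 h C) ∧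
      (S.e₁ h α β γ = 0 → S.Case8 h C) ∧
      (S.e₁ h α β γ = 0 → S.l = 0 → S.l₁ = 0 → S.Case9 h C) ∧
      (S.l = 0 → S.Case10 h C) ∧
      (S.l = 0 → S.l₁ = 0 → S.l₂ = 0 → S.Case11 h C) ∧
      (S.l₂ = 0 → S.Case12 h C) ∧
      (S.l₁ = 0 → S.Case13 h C) ∧
      S.Case14 h C := by
  refine ⟨exists_isStandard hp hr hα hβ hγ hC, fun S hS => ?_⟩
  have hgen := hS.gen_all
  have hAz : S.e₁ h α β γ = 0 → cls α S.A = 0 := fun h1 => (vec_eq_zero_iff.1 h1).1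
  have hBz : S.e₂ h α β γ = 0 → cls β S.B = 0 := fun h2 => (vec_eq_zero_iff.1 h2).2.1
  have hBl₂ := hS.dvdMod_hG_mul_l₂ hr
  -- When the second generator vanishes, `ℬ = 0` forces `h_𝒢 l₂ = 0` in the quotient, so `Q = 0` is
  -- an admissible quotient.
  have hBzl₂ : S.e₂ h α β γ = 0 → cls β (0 * S.B) = cls β (S.hG h γ * S.l₂) := fun h2 => by
    rw [zero_mul, map_zero, cls_eq_zero_iff.2 (dvd_of_dvdMod (hBz h2) hBl₂)]
  refine ⟨fun h2 h3 => ?_, fun h1 hl h3 => ?_, fun h1 h2 hl₁ hl₂ => ?_, fun h1 h3 => ?_,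
    fun h1 h2 => ?_, fun h3 => ?_, fun h2 => ?_, fun h1 => ?_, fun h1 hl hl₁ => ?_,
    fun hl => ?_, fun hl hl₁ hl₂ => ?_, fun hl₂ => ?_, fun hl₁ => ?_, hS.case14 hr⟩
  · rw [h2, h3, gen_triple_zero, gen_pair_zero] at hgen
    exact ⟨hgen, hS.chain_a⟩
  · rw [h1, h3, gen_insert_zero, gen_pair_zero, e₂, hl] at hgen
    exact ⟨hgen, hS.chain_b⟩
  · rw [h1, h2, gen_insert_zero, gen_insert_zero, e₃, hl₁, hl₂] at hgen
    exact ⟨hgen, hS.chain_g⟩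
  · rw [h1, h3, gen_insert_zero, gen_pair_zero] at hgen
    exact ⟨hgen, hS.chain_b, dvd_of_dvdMod (hAz h1) (hS.dvdMod_hB_mul_l hr)⟩
  · rw [h1, h2, gen_insert_zero, gen_insert_zero] at hgen
    exact ⟨hgen, hS.chain_g,
      dvd_of_dvdMod (hAz h1) (hS.dvdMod_hG_mul_l₁ hr (hBzl₂ h2) (zero_mul _)),
      dvd_of_dvdMod (hBz h2) hBl₂⟩
  · rw [h3, gen_triple_zero] at hgen
    exact ⟨hgen, hS.chain_a, hS.chain_b, hS.deg_l, hS.dvdMod_hB_mul_l hr⟩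
  · rw [h2, Set.insert_comm, gen_insert_zero] at hgen
    exact ⟨hgen, hS.chain_a, hS.chain_g, hS.deg_l₁,
      hS.dvdMod_hG_mul_l₁ hr (hBzl₂ h2) (zero_mul _), dvd_of_dvdMod (hBz h2) hBl₂⟩
  · rw [h1, gen_insert_zero] at hgen
    exact ⟨hgen, hS.chain_b, hS.chain_g, hS.deg_l₂,
      dvd_of_dvdMod (hAz h1) (hS.dvdMod_hB_mul_l hr), hBl₂,
      fun Q hQ => dvd_of_dvdMod (hAz h1) (hS.dvdMod_sub hr hQ)⟩
  · rw [h1, gen_insert_zero, e₂, e₃, hl, hl₁] at hgen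
    exact ⟨hgen, hS.chain_b, hS.chain_g, hS.deg_l₂, hBl₂⟩
  · rw [e₂, hl] at hgen
    -- Any quotient `Q` serves here: its contribution `Q l` vanishes because `l = 0`.
    obtain ⟨q, hq⟩ := hBl₂
    obtain ⟨Q, rfl⟩ := Ideal.Quotient.mk_surjective q
    have hQ : cls β (Q * S.B) = cls β (S.hG h γ * S.l₂) := by rw [hq, map_mul, mul_comm]
    exact ⟨hgen, hS.chain_a, hS.chain_b, hS.chain_g, hS.deg_l₁,
      hS.dvdMod_hG_mul_l₁ hr hQ (by rw [hl, mul_zero]), hS.deg_l₂, hS.dvdMod_hG_mul_l₂ hr⟩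
  · rw [e₂, e₃, hl, hl₁, hl₂] at hgen
    exact ⟨hgen, hS.chain_a, hS.chain_b, hS.chain_g⟩
  · rw [e₃, hl₂] at hgen
    exact ⟨hgen, hS.chain_a, hS.chain_b, hS.chain_g, hS.deg_l, hS.deg_l₁,
      hS.dvdMod_hG_mul_l₁ hr (Q := 0) (by rw [hl₂, zero_mul, mul_zero]) (zero_mul _),
      hS.dvdMod_hB_mul_l hr⟩
  · rw [e₃, hl₁] at hgen
    exact ⟨hgen, hS.chain_a, hS.chain_b, hS.chain_g, hS.deg_l, hS.dvdMod_hB_mul_l hr,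
      hS.deg_l₂, hBl₂⟩
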